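/- **Setting.** $\mathcal{FL}_\bot$-concepts are built from concept names and role names by $C ::= A \mid C\sqcap C \mid \forall r.C \mid \top \mid \bot$ with the usual set semantics, and $C \sqsubseteq D$ means $C^I\subseteq D^I$ for every interpretation $I$. A *particle* is a concept $\forall r_1.\cdots\forall r_n.B$, written $\forall v.B$ with $v=r_1\cdots r_n$, where $B$ is a concept name, $\top$ or $\bot$. A concept in normal form is a finite set of particles, read as their conjunction. A particle $\forall v.\bot$ is a *prefix* of $\forall v'.\bot$ if $v$ is a proper prefix of $v'$, and of $\forall v'.A$ ($A$ a concept name) if $v$ is a prefix of $v'$. A normal form is *reduced* if it has no particle $\forall v.\top$ and no particle in it has a prefix in it. **Normalized problems.** A normalized unification problem $\Gamma$ has a finite set $\mathbf{Var}$ of variables and one constant $A$, and consists of * start subsumptions $X\sqsubseteq^? \bot$ for $X\in S^\bot_{ini}$ (the variables chosen to be $\bot$) and $X\sqsubseteq^? A$ for $X\in S^A_{ini}$ (the variables chosen to contain $A$); * increasing subsumptions $X\sqsubseteq^?\forall r.X^r$ whenever the $r$-decomposition variable $X^r\in\mathbf{Var}$ of $X$ is defined; a decomposition variable has only one parent $X$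 and one role $r$, and variables in $S^\bot_{ini}$ have no decomposition variables; * flat subsumptions $X_1\sqcap\cdots\sqcap X_n\sqsubseteq^? Y$ between variables. The set of start subsumptions is assumed to be non-empty. A *ground unifier* $\gamma$ of $\Gamma$ assigns to each variable a reduced normal form without variables, so that all these subsumptions hold after substitution. It *agrees with the choices* of $\Gamma$ if $S^\bot_{ini}=\{X\mid \gamma(X)=\{\bot\}\}$ and $S^A_{ini}=\{X\mid A\in\gamma(X)\}$. It *obeys the decreasing rule* if, whenever $X^r$ is defined and $\forall r.P\in\gamma(X)$, also $P\in\gamma(X^r)$. **Shortcuts.** A *shortcut* is a pair $(\mathcal S,\mathcal P)$ of disjoint sets of variables such that $\mathcal S\neq\emptyset$; if $\mathcal S\cap S^\bot_{ini}\ne\emptyset$ then $\mathcal S\subseteq S^\bot_{ini}$ and $\mathcal P=\emptyset$; and for each flat subsumption $X_1\sqcap\cdots\sqcap X_n\sqsubseteq^? Y$: if $Y\in\mathcal S$ then some $X_i\in\mathcal S\cup\mathcal P$, and if $Y\in\mathcal P$ then some $X_i\in\mathcal P$. It has *height $0$* if $\mathcal S$ contains no decomposition variable. Write $(\mathcal S_1,\mathcal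 P_1)\xrightarrow{r}(\mathcal S_2,\mathcal P_2)$ (*resolved by*) if $\mathcal S_1$ contains some $r$-decomposition variable; whenever $Y^r$ is defined, $Y^r\in\mathcal S_1\Leftrightarrow Y\in\mathcal S_2$ and $Y^r\in\mathcal P_1\Leftrightarrow Y\in\mathcal P_2$; and, in case $\mathcal S_1\subseteq S^\bot_{ini}$, also $\mathcal P_2\subseteq S^\bot_{ini}$. A shortcut $(\mathcal S,\mathcal P)$ *is supported by* $(\mathcal S',\mathcal P')$ if $\mathcal P=\mathcal S'\cup\mathcal P'$. The initial shortcuts are $s^\bot_{ini}=(S^\bot_{ini},\emptyset)$ and $s^A_{ini}=(S^A_{ini},\mathcal P)$ for any $\mathcal P\subseteq S^\bot_{ini}$ (so "$s^A_{ini}\in\mathfrak S$" means that this holds for some such $\mathcal P$). **Main algorithm on $\Gamma$.** 1. *AllShortcuts.* Let $\mathfrak S$ be the set of shortcuts of height $0$; if it is empty, return failure. Repeat until there is no change: add to $\mathfrak S$ every shortcut $s=(\mathcal S,\mathcal P)$ such that, for each role $r$ with an $r$-decomposition variable in $\mathcal S$, there is $s'\in\mathfrak S$ with $s\xrightarrow{r}s'$.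 2. If $S^\bot_{ini}=\emptyset$: return success if $s^A_{ini}\in\mathfrak S$, and failure otherwise. 3. Otherwise, call *required* the initial shortcut $s^\bot_{ini}$ and, if $S^A_{ini}\ne\emptyset$, also $s^A_{ini}$. If a required initial shortcut is not in $\mathfrak S$, return failure. Repeat until there is no change in $\mathfrak S$: first *CheckExistence* (remove each $(\mathcal S,\mathcal P)\in\mathfrak S$ with $\mathcal P\neq\emptyset$ that no element of $\mathfrak S$ supports), then *CheckValidity* (remove each $s\in\mathfrak S$ from which no shortcut of height $0$ in $\mathfrak S$ can be reached by zero or more resolving steps, with respect to any roles, inside $\mathfrak S$). Return success if all the required initial shortcuts are still in $\mathfrak S$, and failure otherwise. **Theorem (Completeness).** Let $\Gamma$ be a normalized $\mathcal{FL}_\bot$ unification problem with at least one start subsumption, and let $\gamma$ be a ground unifier of $\Gamma$ that agrees with the choices of $\Gamma$ and obeys the decreasing rule. Then the main algorithm on $\Gamma$ terminates with success. -/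

import Mathlib

universe u v w

namespace FLBot

/-! ### The description logic: syntax and semantics -/

/-- Concepts over the concept names `N` and the role names `R`. -/
inductive Concept (N : Type v) (R : Type u) : Type (max u v)
  | name : N → Concept N R
  | conj : Concept N R → Concept N R → Concept N R
  | all : R → Concept N R → Concept N R
  | top : Concept N R
  | bot : Concept N R

/-- An interpretation: a non-empty domain, with concept names read as subsets of it and role names
as binary relations on it. -/
structure Interpretation (N : Type v) (R : Type u) where
  Domain : Type u
  nonempty : Nonempty Domain
  nameSet : N → Set Domain
  roleRel : R → Domain → Domain → Prop

/-- The interpretation of a concept. -/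
def Concept.eval {N : Type v} {R : Type u} (I : Interpretation N R) :
    Concept N R → Set I.Domain
  | .name A => I.nameSet A
  | .conj C D => C.eval I ∩ D.eval I
  | .all r C => {e | ∀ d, I.roleRel r e d → d ∈ C.eval I}
  | .top => Set.univ
  | .bot => ∅

/-- Subsumption `C ⊑ D`. -/
def Subsumes {N : Type v} {R : Type u} (C D : Concept N R) : Prop :=
  ∀ I : Interpretation N R, C.eval I ⊆ D.eval I

/-- Conjunction of a list of concepts; the empty conjunction is `⊤`. -/
def Concept.conjList {N : Type v} {R : Type u} (l : List (Concept N R)) : Concept N R :=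
  l.foldr Concept.conj Concept.top

/-- Replace variables by concepts; the concept names are the variables `V` and the constants `N`. -/
def Concept.subst {V : Type w} {N : Type v} {R : Type u} (σ : V → Concept N R) :
    Concept (V ⊕ N) R → Concept N R
  | .name (.inl X) => σ X
  | .name (.inr A) => .name A
  | .conj C D => .conj (C.subst σ) (D.subst σ)
  | .all r C => .all r (C.subst σ)
  | .top => .top
  | .bot => .bot

/-! ### Particles and reduced normal forms -/

/-- What a particle may end in: a concept name, `⊤` or `⊥`. -/
inductive Head (N : Type v) : Type v
  | name : N → Head N
  | top : Head N
  | bot : Head N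

/-- The particle `∀ v. B`, where `v` is the role string `roles`. -/
structure Particle (N : Type v) (R : Type u) where
  roles : List R
  head : Head N

def Head.toConcept {N : Type v} {R : Type u} : Head N → Concept N R
  | .name A => .name A
  | .top => .top
  | .bot => .bot

def Particle.toConcept {N : Type v} {R : Type u} (P : Particle N R) : Concept N R :=
  P.roles.foldr Concept.all P.head.toConcept

/-- The particle `∀ r. P`. -/
def Particle.all {N : Type v} {R : Type u} (r : R) (P : Particle N R) : Particle N R :=
  ⟨r :: P.roles, P.head⟩

/-- The particle `⊥`. -/
def Particle.bot {N : Type v} {R : Type u} : Particle N R := ⟨[], .bot⟩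

/-- The particle `A`, for a concept name `A`. -/
def Particle.name {N : Type v} {R : Type u} (A : N) : Particle N R := ⟨[], .name A⟩

/-- `P` is a prefix of `Q`: `P = ∀ v. ⊥`, and either `Q = ∀ v'. ⊥` with `v < v'`, or
`Q = ∀ v'. A` with a concept name `A` and `v ≤ v'`. -/
def Particle.IsPrefixOf {N : Type v} {R : Type u} (P Q : Particle N R) : Prop :=
  P.head = .bot ∧
    ((Q.head = .bot ∧ P.roles <+: Q.roles ∧ P.roles ≠ Q.roles) ∨
      (∃ A, Q.head = .name A) ∧ P.roles <+: Q.roles)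

/-- A concept in normal form is a finite set of particles, read as their conjunction. -/
abbrev NormalForm (N : Type v) (R : Type u) : Type (max u v) := Finset (Particle N R)

noncomputable def NormalForm.toConcept {N : Type v} {R : Type u} (C : NormalForm N R) :
    Concept N R :=
  Concept.conjList ((Finset.toList C).map Particle.toConcept)

/-- No deletion applies: there is no `⊤`-particle, and no particle has a prefix in the set. -/
def NormalForm.Reduced {N : Type v} {R : Type u} (C : NormalForm N R) : Prop :=
  (∀ P ∈ C, P.head ≠ .top) ∧ ∀ P ∈ C, ∀ Q ∈ C, ¬ P.IsPrefixOf Q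

/-! ### Normalized unification problems -/

/-- A normalized unification problem with variables `V`, constants from `N` and roles `R`, in
which (at most) the one constant `const` occurs.

* `botVars` is the set of variables `X` with a start subsumption `X ⊑? ⊥`;
* `constVars` is the set of variables `X` with a start subsumption `X ⊑? A`, where `A = const`;
* `dec X r = some Y` says that `X` has the `r`-decomposition variable `Y = X^r`; then there is an
  increasing subsumption `X ⊑? ∀ r. X^r`;
* `(L, Y) ∈ flat` is the flat subsumption `⊓ L ⊑? Y`.

A decomposition variable has one parent and one role. A variable chosen to be `⊥` has been
replaced by `⊥` during normalization, so that it was never decomposed. -/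
structure NormalizedProblem (V : Type w) (N : Type v) (R : Type u) where
  const : N
  botVars : Finset V
  constVars : Finset V
  dec : V → R → Option V
  flat : Finset (Finset V × V)
  dec_inj : ∀ X X' r r' Y, dec X r = some Y → dec X' r' = some Y → X = X' ∧ r = r'
  dec_bot : ∀ X ∈ botVars, ∀ r, dec X r = none

namespace NormalizedProblem

variable {V : Type w} {N : Type v} {R : Type u}

/-- A variable as a concept. -/
def var (X : V) : Concept (V ⊕ N) R := .name (.inl X)

/-- The start subsumptions, as pairs (left-hand side, right-hand side). -/
def startGoals (Γ : NormalizedProblem V N R) : Set (Concept (V ⊕ N) R × Concept (V ⊕ N) R) :=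
  {p | ∃ X ∈ Γ.constVars, p = (var X, .name (.inr Γ.const))} ∪
    {p | ∃ X ∈ Γ.botVars, p = (var X, .bot)}

/-- The increasing subsumptions. -/
def increasingGoals (Γ : NormalizedProblem V N R) :
    Set (Concept (V ⊕ N) R × Concept (V ⊕ N) R) :=
  {p | ∃ X r Y, Γ.dec X r = some Y ∧ p = (var X, .all r (var Y))}

/-- The flat subsumptions. -/
def flatGoals (Γ : NormalizedProblem V N R) : Set (Concept (V ⊕ N) R × Concept (V ⊕ N) R) :=
  {p | ∃ s ∈ Γ.flat, p = (Concept.conjList (s.1.toList.map var), var s.2)}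

/-- All goal subsumptions. -/
def goals (Γ : NormalizedProblem V N R) : Set (Concept (V ⊕ N) R × Concept (V ⊕ N) R) :=
  Γ.startGoals ∪ Γ.increasingGoals ∪ Γ.flatGoals

/-- The ground substitution `γ` is a unifier of `Γ`. -/
def IsUnifier (Γ : NormalizedProblem V N R) (γ : V → NormalForm N R) : Prop :=
  ∀ p ∈ Γ.goals, Subsumes (p.1.subst fun X => (γ X).toConcept) (p.2.subst fun X => (γ X).toConcept)

/-- If `∀ r. P ∈ γ(X)` and `X^r` is defined, then `P ∈ γ(X^r)`. -/
def ObeysDecreasingRule (Γ : NormalizedProblem V N R) (γ : V → NormalForm N R) : Prop :=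
  ∀ X r Y, Γ.dec X r = some Y → ∀ P : Particle N R, P.all r ∈ γ X → P ∈ γ Y

/-- `γ` agrees with the choices for variables that `Γ` was normalized with: the `⊥`-variables of
`γ` are those chosen to be `⊥`, and `A_X` was chosen to be true exactly if `A ∈ γ(X)`. -/
def AgreesWithChoices (Γ : NormalizedProblem V N R) (γ : V → NormalForm N R) : Prop :=
  ∀ X, (X ∈ Γ.botVars ↔ γ X = {Particle.bot}) ∧
    (X ∈ Γ.constVars ↔ Particle.name Γ.const ∈ γ X)

/-! ### Shortcuts -/

/-- The pair `s = (s.1, s.2)`, with main part `s.1` and prefix part `s.2`, satisfies the flat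
subsumption `⊓ L ⊑? X`. -/
def PairSatisfies (s : Finset V × Finset V) (L : Finset V) (X : V) : Prop :=
  (X ∈ s.1 → ∃ Y ∈ L, Y ∈ s.1 ∨ Y ∈ s.2) ∧ (X ∈ s.2 → ∃ Y ∈ L, Y ∈ s.2)

/-- The pair `s` is a shortcut. -/
structure IsShortcut (Γ : NormalizedProblem V N R) (s : Finset V × Finset V) : Prop where
  disjoint : Disjoint s.1 s.2
  nonempty : s.1.Nonempty
  bottom : (∃ X ∈ s.1, X ∈ Γ.botVars) → s.1 ⊆ Γ.botVars ∧ s.2 = ∅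
  satisfies : ∀ f ∈ Γ.flat, PairSatisfies s f.1 f.2

/-- The set `S` contains an `r`-decomposition variable. -/
def HasDecVar (Γ : NormalizedProblem V N R) (r : R) (S : Finset V) : Prop :=
  ∃ X Y, Γ.dec X r = some Y ∧ Y ∈ S

/-- The resolving relation `s₁ →ʳ s₂`. -/
structure ResolvedBy (Γ : NormalizedProblem V N R) (r : R) (s₁ s₂ : Finset V × Finset V) :
    Prop where
  exists_dec : Γ.HasDecVar r s₁.1
  main_parent : ∀ Y Z, Γ.dec Y r = some Z → Z ∈ s₁.1 → Y ∈ s₂.1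
  pre_parent : ∀ Y Z, Γ.dec Y r = some Z → Z ∈ s₁.2 → Y ∈ s₂.2
  main_dec : ∀ Y Z, Γ.dec Y r = some Z → Y ∈ s₂.1 → Z ∈ s₁.1
  pre_dec : ∀ Y Z, Γ.dec Y r = some Z → Y ∈ s₂.2 → Z ∈ s₁.2
  bottom : s₁.1 ⊆ Γ.botVars → s₂.2 ⊆ Γ.botVars

/-- `s` depends on `s'` (`s'` supports `s`): the prefix part of `s` is the union of the two parts
of `s'`. -/
def DependsOn (s s' : Finset V × Finset V) : Prop :=
  ∀ X, X ∈ s.2 ↔ X ∈ s'.1 ∨ X ∈ s'.2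

/-- `s` is of height `0`: its main part contains no decomposition variable. -/
def HeightZero (Γ : NormalizedProblem V N R) (s : Finset V × Finset V) : Prop :=
  ∀ r, ¬ Γ.HasDecVar r s.1

end NormalizedProblem

/-! ### The main algorithm -/

/-- `repeat a ← f a until there is no change`, for an `f` under which the measure `m` drops at each
change, so that the loop terminates. -/
noncomputable def repeatLoop {α : Type w} (f : α → α) (m : α → ℕ)
    (h : ∀ a, f a ≠ a → m (f a) < m a) (a : α) : α :=
  open Classical in
  if _hf : f a = a then a else repeatLoop f m h (f a)
termination_by m a
decreasing_by exact h a _hf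

inductive Outcome
  | success
  | failure

namespace NormalizedProblem

variable {V : Type w} {N : Type v} {R : Type u} [Fintype V]

/-- The shortcuts of height `0`. -/
noncomputable def heightZeroShortcuts (Γ : NormalizedProblem V N R) :
    Finset (Finset V × Finset V) :=
  open Classical in
  Finset.univ.filter fun s => Γ.IsShortcut s ∧ Γ.HeightZero s

/-- One pass of the loop of `AllShortcuts`: add the shortcuts that are resolved by an already
computed shortcut, for each role that has a decomposition variable in the main part. -/
noncomputable def addShortcuts (Γ : NormalizedProblem V N R)
    (S : Finset (Finset V × Finset V)) : Finset (Finset V × Finset V) :=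
  open Classical in
  S ∪ Finset.univ.filter fun s =>
    Γ.IsShortcut s ∧ ∀ r, Γ.HasDecVar r s.1 → ∃ s' ∈ S, Γ.ResolvedBy r s s'

theorem addShortcuts_measure (Γ : NormalizedProblem V N R) (S : Finset (Finset V × Finset V))
    (h : Γ.addShortcuts S ≠ S) :
    Fintype.card (Finset V × Finset V) - (Γ.addShortcuts S).card <
      Fintype.card (Finset V × Finset V) - S.card := by
  classical
  have hsub : S ⊆ Γ.addShortcuts S := by
    unfold addShortcuts
    intro s hs
    simp [hs]
  have h1 := Finset.card_lt_card (hsub.ssubset_of_ne (Ne.symm h))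
  have h2 := Finset.card_le_univ (Γ.addShortcuts S)
  omega

/-- The procedure `AllShortcuts` (when there are shortcuts of height `0`). -/
noncomputable def allShortcuts (Γ : NormalizedProblem V N R) : Finset (Finset V × Finset V) :=
  repeatLoop Γ.addShortcuts (fun S => Fintype.card (Finset V × Finset V) - S.card)
    Γ.addShortcuts_measure Γ.heightZeroShortcuts

/-- The procedure `CheckExistence`: remove the shortcuts with a non-empty prefix part that no
shortcut in the set supports. -/
noncomputable def checkExistence (S : Finset (Finset V × Finset V)) :
    Finset (Finset V × Finset V) :=
  open Classical in
  S.filter fun s => s.2 = ∅ ∨ ∃ s' ∈ S, DependsOn s s'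

/-- The procedure `CheckValidity`: remove the shortcuts from which no shortcut of height `0` is
reachable, along the resolving relation between shortcuts in the set. -/
noncomputable def checkValidity (Γ : NormalizedProblem V N R)
    (S : Finset (Finset V × Finset V)) : Finset (Finset V × Finset V) :=
  open Classical in
  S.filter fun s => ∃ s₀ ∈ S, Γ.HeightZero s₀ ∧
    Relation.ReflTransGen (fun a b => a ∈ S ∧ b ∈ S ∧ ∃ r, Γ.ResolvedBy r a b) s s₀

/-- The body of the repeat-loop of the main algorithm. -/
noncomputable def prune (Γ : NormalizedProblem V N R) (S : Finset (Finset V × Finset V)) :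
    Finset (Finset V × Finset V) :=
  Γ.checkValidity (checkExistence S)

theorem prune_measure (Γ : NormalizedProblem V N R) (S : Finset (Finset V × Finset V))
    (h : Γ.prune S ≠ S) : (Γ.prune S).card < S.card := by
  classical
  have hsub : Γ.prune S ⊆ S := by
    unfold prune checkValidity checkExistence
    exact (Finset.filter_subset _ _).trans (Finset.filter_subset _ _)
  exact Finset.card_lt_card (hsub.ssubset_of_ne h)

/-- The whole repeat-loop of the main algorithm. -/
noncomputable def pruneLoop (Γ : NormalizedProblem V N R) (S : Finset (Finset V × Finset V)) :
    Finset (Finset V × Finset V) :=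
  repeatLoop Γ.prune Finset.card Γ.prune_measure S

/-- The initial shortcut for `⊥` is in `S`. -/
def BotInitialIn (Γ : NormalizedProblem V N R) (S : Finset (Finset V × Finset V)) : Prop :=
  (Γ.botVars, ∅) ∈ S

/-- An initial shortcut for the constant is in `S`. -/
def ConstInitialIn (Γ : NormalizedProblem V N R) (S : Finset (Finset V × Finset V)) : Prop :=
  ∃ Q ⊆ Γ.botVars, (Γ.constVars, Q) ∈ S

/-- The main algorithm. -/
noncomputable def main (Γ : NormalizedProblem V N R) : Outcome :=
  open Classical in
  if Γ.heightZeroShortcuts = ∅ then .failure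
  else if Γ.botVars = ∅ then
    if Γ.ConstInitialIn Γ.allShortcuts then .success else .failure
  else if Γ.constVars = ∅ then
    if ¬ Γ.BotInitialIn Γ.allShortcuts then .failure
    else if Γ.BotInitialIn (Γ.pruneLoop Γ.allShortcuts) then .success
    else .failure
  else
    if ¬ Γ.BotInitialIn Γ.allShortcuts ∨ ¬ Γ.ConstInitialIn Γ.allShortcuts then .failure
    else if Γ.BotInitialIn (Γ.pruneLoop Γ.allShortcuts) ∧
        Γ.ConstInitialIn (Γ.pruneLoop Γ.allShortcuts) then .success
    else .failure

end NormalizedProblem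

end FLBot

namespace FLBot

variable {V : Type w} {N : Type v} {R : Type u}

/-! ### Particles entailed by a set of particles -/

/-! To each particle `P` occurring in `γ` attach the pair of the variables containing `P` and those
containing a prefix of `P` (`particlePair`). These pairs form a family of shortcuts that the
algorithm finds and never discards, and the initial shortcuts belong to it: they are the pairs of
`⊥` and of `A`.

A set of particles entails a particle other than a `⊤`-particle only if it contains it or a prefix
of it (`mem_or_exists_isPrefixOf_of_entails`). Hence the pairs satisfy the flat subsumptions.
Combined with the decreasing rule and reducedness, the same fact makes `∀ r. P ∈ γ X` equivalent to
`P ∈ γ (X^r)`, so the pair of `P` is resolved by that of `∀ r. P` whenever its main part has an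
`r`-decomposition variable.

Particles in `γ` have bounded length, so resolving ends at height 0: induction from long particles
to short ones puts the family into `allShortcuts` and gives reachability. The longest prefix of `P`
occurring in `γ` supplies support, so pruning preserves the family. -/

theorem Concept.mem_eval_conjList (I : Interpretation N R) (x : I.Domain)
    (l : List (Concept N R)) :
    x ∈ (Concept.conjList l).eval I ↔ ∀ C ∈ l, x ∈ C.eval I := by
  induction l with
  | nil => simp [Concept.conjList, Concept.eval]
  | cons C l ih =>
    rw [List.forall_mem_cons, ← ih]
    rfl

theorem NormalForm.mem_eval_toConcept (I : Interpretation N R) (x : I.Domain)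
    (C : NormalForm N R) :
    x ∈ C.toConcept.eval I ↔ ∀ P ∈ C, x ∈ P.toConcept.eval I := by
  simp [NormalForm.toConcept, Concept.mem_eval_conjList]

theorem Concept.subst_conjList_var (σ : V → Concept N R) (l : List V) :
    (Concept.conjList (l.map NormalizedProblem.var)).subst σ = Concept.conjList (l.map σ) := by
  induction l with
  | nil => rfl
  | cons X l ih =>
    change Concept.conj (σ X) _ = Concept.conj (σ X) _
    exact congrArg _ ih

/-- The tree of role strings, cut off where a `⊥`-particle of `K` applies. -/
def canonicalInterpretation (K : Set (Particle N R)) : Interpretation N R where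
  Domain := List R
  nonempty := ⟨[]⟩
  nameSet A := {x | ⟨x, .name A⟩ ∈ K}
  roleRel r x y := y = x ++ [r] ∧ ∀ Q ∈ K, Q.head = .bot → ¬ Q.roles <+: y

/-- No edge enters a cut-off node, so `hx` is inherited along the walk; a final `⊥` would cut off
the node where the walk ends. -/
theorem mem_eval_canonical_of_mem {K : Set (Particle N R)} {B : Head N} (v x : List R)
    (hx : ∀ Q ∈ K, Q.head = .bot → ¬ Q.roles <+: x) (h : ⟨x ++ v, B⟩ ∈ K) :
    x ∈ (v.foldr Concept.all B.toConcept).eval (canonicalInterpretation K) := by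
  induction v generalizing x with
  | nil =>
    rw [List.append_nil] at h
    cases B with
    | name A => exact h
    | top => exact Set.mem_univ _
    | bot => exact (hx _ h rfl (List.prefix_refl x)).elim
  | cons r v ih =>
    rintro y ⟨rfl, hy⟩
    exact ih _ hy (by simpa using h)

/-- Either the walk along `v` reaches `x ++ v`, where only names prescribed by `K` hold, or some
`⊥`-particle of `K` blocks it and is the prefix sought. -/
theorem mem_of_mem_eval_canonical {K : Set (Particle N R)} {B : Head N} (hB : B ≠ .top)
    (v x : List R) (hx : ∀ Q ∈ K, Q.head = .bot → ¬ Q.roles <+: x)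
    (h : x ∈ (v.foldr Concept.all B.toConcept).eval (canonicalInterpretation K)) :
    ⟨x ++ v, B⟩ ∈ K ∨ ∃ Q ∈ K, Q.head = .bot ∧ Q.roles <+: x ++ v := by
  induction v generalizing x with
  | nil =>
    cases B with
    | name A => exact .inl (by rw [List.append_nil]; exact h)
    | top => exact (hB rfl).elim
    | bot => exact h.elim
  | cons r v ih =>
    by_cases hy : ∀ Q ∈ K, Q.head = .bot → ¬ Q.roles <+: x ++ [r]
    · simpa using ih (x ++ [r]) hy (h _ ⟨rfl, hy⟩)
    · push Not at hy
      obtain ⟨Q, hQ, hQb, hQr⟩ := hy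
      exact .inr ⟨Q, hQ, hQb, hQr.trans ⟨v, by simp⟩⟩

theorem mem_or_exists_isPrefixOf_of_entails {K : Set (Particle N R)} {P : Particle N R}
    (hP : P.head ≠ .top)
    (h : ∀ (I : Interpretation N R) (x : I.Domain), (∀ Q ∈ K, x ∈ Q.toConcept.eval I) →
      x ∈ P.toConcept.eval I) :
    P ∈ K ∨ ∃ Q ∈ K, Q.IsPrefixOf P := by
  have key : P ∈ K ∨ ∃ Q ∈ K, Q.head = .bot ∧ Q.roles <+: P.roles := by
    -- The root is cut off only if `⊥` itself is in `K`, and the empty role string is a prefix of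
    -- every other.
    by_cases hx : ∀ Q ∈ K, Q.head = .bot → ¬ Q.roles <+: ([] : List R)
    · exact mem_of_mem_eval_canonical hP P.roles [] hx
        (h (canonicalInterpretation K) [] fun Q hQ => mem_eval_canonical_of_mem Q.roles [] hx hQ)
    · push Not at hx
      obtain ⟨Q, hQ, hQb, hQr⟩ := hx
      exact .inr ⟨Q, hQ, hQb, hQr.trans List.nil_prefix⟩
  rcases key with hK | ⟨Q, hQ, hQb, hQr⟩
  · exact .inl hK
  · obtain ⟨v, B⟩ := P
    obtain ⟨u, D⟩ := Q
    obtain rfl : D = .bot := hQb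
    cases B with
    | name A => exact .inr ⟨_, hQ, rfl, .inr ⟨⟨A, rfl⟩, hQr⟩⟩
    | top => exact (hP rfl).elim
    | bot =>
      -- Prefixes among `⊥`-particles are proper; equal role strings mean that `P` itself is in `K`.
      by_cases huv : u = v
      · exact .inl (huv ▸ hQ)
      · exact .inr ⟨_, hQ, rfl, .inl ⟨rfl, hQr, huv⟩⟩

/-! ### The prefix relation between particles -/

theorem Particle.IsPrefixOf.trans {P Q T : Particle N R} (h : P.IsPrefixOf Q)
    (h' : Q.IsPrefixOf T) : P.IsPrefixOf T := by
  obtain ⟨hP, ⟨hQ, hPQ, hne⟩ | ⟨⟨A, hA⟩, hPQ⟩⟩ := h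
  · refine ⟨hP, h'.2.imp ?_ ?_⟩
    · rintro ⟨hT, hQT, -⟩
      refine ⟨hT, hPQ.trans hQT, fun he => hne (hPQ.eq_of_length_le ?_)⟩
      rw [he]
      exact hQT.length_le
    · rintro ⟨hT, hQT⟩
      exact ⟨hT, hPQ.trans hQT⟩
  · exact absurd h'.1 (by simp [hA])

theorem Particle.all_isPrefixOf_all {r : R} {P Q : Particle N R} :
    (P.all r).IsPrefixOf (Q.all r) ↔ P.IsPrefixOf Q := by
  simp [Particle.IsPrefixOf, Particle.all]

theorem Particle.IsPrefixOf.eq_bot_or_eq_all {r : R} {P Q : Particle N R}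
    (h : P.IsPrefixOf (Q.all r)) :
    P = Particle.bot ∨ ∃ P' : Particle N R, P = P'.all r ∧ P'.IsPrefixOf Q := by
  obtain ⟨u, B⟩ := P
  obtain rfl : B = .bot := h.1
  cases u with
  | nil => exact .inl rfl
  | cons s u =>
    have hs : s = r := by
      rcases h.2 with ⟨-, h, -⟩ | ⟨-, h⟩ <;> exact (List.cons_prefix_cons.mp h).1
    subst hs
    exact .inr ⟨⟨u, .bot⟩, rfl, Particle.all_isPrefixOf_all.mp h⟩

theorem Particle.not_isPrefixOf_bot (P : Particle N R) : ¬ P.IsPrefixOf Particle.bot := by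
  rintro ⟨-, ⟨-, h, hne⟩ | ⟨⟨A, hA⟩, -⟩⟩
  · exact hne (List.prefix_nil.mp h)
  · cases hA

theorem Particle.bot_isPrefixOf {P : Particle N R} (hP : P.head ≠ .top)
    (hne : P ≠ Particle.bot) : Particle.bot.IsPrefixOf P := by
  obtain ⟨v, B⟩ := P
  refine ⟨rfl, ?_⟩
  cases B with
  | name A => exact .inr ⟨⟨A, rfl⟩, List.nil_prefix⟩
  | top => exact (hP rfl).elim
  | bot => exact .inl ⟨rfl, List.nil_prefix, fun h => hne (by cases h; rfl)⟩

theorem Particle.isPrefixOf_name {P : Particle N R} {A : N} :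
    P.IsPrefixOf (Particle.name A) ↔ P = Particle.bot := by
  constructor
  · rintro ⟨hP, ⟨h, -⟩ | ⟨-, h⟩⟩
    · cases h
    · obtain ⟨v, B⟩ := P
      obtain rfl : B = .bot := hP
      obtain rfl : v = [] := List.prefix_nil.mp h
      rfl
  · rintro rfl
    exact Particle.bot_isPrefixOf (by simp [Particle.name]) (by simp [Particle.name, Particle.bot])

/-- The prefixes of a fixed particle form a chain, ordered by length. -/
theorem Particle.IsPrefixOf.of_length_le {P Q T : Particle N R} (hP : P.IsPrefixOf T)
    (hQ : Q.IsPrefixOf T) (hle : P.roles.length ≤ Q.roles.length) :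
    P = Q ∨ P.IsPrefixOf Q := by
  have hPr : P.roles <+: T.roles := by rcases hP.2 with ⟨-, h, -⟩ | ⟨-, h⟩ <;> exact h
  have hQr : Q.roles <+: T.roles := by rcases hQ.2 with ⟨-, h, -⟩ | ⟨-, h⟩ <;> exact h
  have hPQ := List.prefix_of_prefix_length_le hPr hQr hle
  have hPb := hP.1
  have hQb := hQ.1
  by_cases he : P.roles = Q.roles
  · left
    cases P
    cases Q
    simp_all
  · exact .inr ⟨hPb, .inl ⟨hQb, hPQ, he⟩⟩

theorem NormalForm.Reduced.eq_singleton_bot {C : NormalForm N R} (hC : C.Reduced)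
    (h : Particle.bot ∈ C) : C = {Particle.bot} := by
  refine Finset.eq_singleton_iff_unique_mem.mpr ⟨h, fun P hP => ?_⟩
  by_contra hne
  exact hC.2 _ h _ hP (Particle.bot_isPrefixOf (hC.1 P hP) hne)

/-! ### Iteration until there is no change -/

theorem repeatLoop_fixed {α : Type w} (f : α → α) (m : α → ℕ)
    (h : ∀ a, f a ≠ a → m (f a) < m a) (a : α) :
    f (repeatLoop f m h a) = repeatLoop f m h a := by
  induction a using repeatLoop.induct f m h with
  | case1 a ha => rw [repeatLoop, dif_pos ha, ha]
  | case2 a ha ih => rwa [repeatLoop, dif_neg ha]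

theorem repeatLoop_invariant {α : Type w} (f : α → α) (m : α → ℕ)
    (h : ∀ a, f a ≠ a → m (f a) < m a) (p : α → Prop) (hp : ∀ a, p a → p (f a)) (a : α)
    (ha : p a) : p (repeatLoop f m h a) := by
  induction a using repeatLoop.induct f m h with
  | case1 a hfa => rwa [repeatLoop, dif_pos hfa]
  | case2 a hfa ih =>
    rw [repeatLoop, dif_neg hfa]
    exact ih (hp a ha)

namespace NormalizedProblem

/-- The result of the loop is a fixed point, so one more pass adds nothing. -/
theorem mem_allShortcuts [Fintype V] {Γ : NormalizedProblem V N R} {s : Finset V × Finset V}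
    (hs : Γ.IsShortcut s)
    (h : ∀ r, Γ.HasDecVar r s.1 → ∃ s' ∈ Γ.allShortcuts, Γ.ResolvedBy r s s') :
    s ∈ Γ.allShortcuts := by
  classical
  have hfix : Γ.addShortcuts Γ.allShortcuts = Γ.allShortcuts := repeatLoop_fixed _ _ _ _
  rw [← hfix]
  simp only [addShortcuts, Finset.mem_union, Finset.mem_filter, Finset.mem_univ, true_and]
  exact .inr ⟨hs, h⟩

/-! ### Consequences of being a unifier -/

variable {Γ : NormalizedProblem V N R} {γ : V → NormalForm N R}

theorem IsUnifier.flat (hγ : Γ.IsUnifier γ) {f : Finset V × V} (hf : f ∈ Γ.flat)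
    {P : Particle N R} (hP : P.head ≠ .top) (hmem : P ∈ γ f.2) :
    ∃ X ∈ f.1, P ∈ γ X ∨ ∃ Q ∈ γ X, Q.IsPrefixOf P := by
  have hsub := hγ _ (.inr ⟨f, hf, rfl⟩)
  have key := mem_or_exists_isPrefixOf_of_entails
    (K := {Q | ∃ X ∈ f.1, Q ∈ γ X}) hP fun I x hx => by
      refine (NormalForm.mem_eval_toConcept I x (γ f.2)).mp (hsub I ?_) P hmem
      dsimp only
      rw [Concept.subst_conjList_var, Concept.mem_eval_conjList]
      simp only [List.mem_map, Finset.mem_toList, forall_exists_index, and_imp,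
        forall_apply_eq_imp_iff₂]
      exact fun X hX => (NormalForm.mem_eval_toConcept I x _).mpr fun Q hQ => hx Q ⟨X, hX, hQ⟩
  rcases key with ⟨X, hX, h⟩ | ⟨Q, ⟨X, hX, h⟩, hQ⟩
  · exact ⟨X, hX, .inl h⟩
  · exact ⟨X, hX, .inr ⟨Q, h, hQ⟩⟩

theorem IsUnifier.increasing (hγ : Γ.IsUnifier γ) {X Y : V} {r : R} (hd : Γ.dec X r = some Y)
    {P : Particle N R} (hP : P.head ≠ .top) (hmem : P ∈ γ Y) :
    P.all r ∈ γ X ∨ ∃ Q ∈ γ X, Q.IsPrefixOf (P.all r) := by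
  have hsub := hγ _ (.inl (.inr ⟨X, r, Y, hd, rfl⟩))
  exact mem_or_exists_isPrefixOf_of_entails (K := {Q | Q ∈ γ X}) (P := P.all r) hP
    fun I x hx y hy => (NormalForm.mem_eval_toConcept I y (γ Y)).mp
      (hsub I ((NormalForm.mem_eval_toConcept I x _).mpr hx) y hy) P hmem

/-! ### The shortcut of a particle -/

/-- The pair of the variables that contain `P` and the variables that contain a prefix of `P`. -/
noncomputable def particlePair [Fintype V] (γ : V → NormalForm N R) (P : Particle N R) :
    Finset V × Finset V :=
  open Classical in
  (Finset.univ.filter fun X => P ∈ γ X,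
    Finset.univ.filter fun X => ∃ Q ∈ γ X, Q.IsPrefixOf P)

section

variable [Fintype V]

@[simp] theorem mem_particlePair_fst {P : Particle N R} {X : V} :
    X ∈ (particlePair γ P).1 ↔ P ∈ γ X := by
  simp [particlePair]

@[simp] theorem mem_particlePair_snd {P : Particle N R} {X : V} :
    X ∈ (particlePair γ P).2 ↔ ∃ Q ∈ γ X, Q.IsPrefixOf P := by
  simp [particlePair]

end

/-- `γ` is a reduced ground unifier of `Γ` that agrees with the choices and obeys the decreasing
rule. -/
structure IsGoodUnifier (Γ : NormalizedProblem V N R) (γ : V → NormalForm N R) : Prop where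
  reduced : ∀ X, (γ X).Reduced
  unifier : Γ.IsUnifier γ
  decreasing : Γ.ObeysDecreasingRule γ
  choices : Γ.AgreesWithChoices γ

namespace IsGoodUnifier

variable (hγ : Γ.IsGoodUnifier γ)

include hγ

/-! ### Particles of a variable and of its decomposition variables -/

theorem mem_botVars_iff {X : V} : X ∈ Γ.botVars ↔ Particle.bot ∈ γ X :=
  (hγ.choices X).1.trans ⟨fun h => h ▸ Finset.mem_singleton_self _,
    fun h => (hγ.reduced X).eq_singleton_bot h⟩

theorem bot_notMem_of_dec {X Y : V} {r : R} (hd : Γ.dec X r = some Y) :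
    Particle.bot ∉ γ X := fun h => by
  simp [Γ.dec_bot X (hγ.mem_botVars_iff.mpr h) r] at hd

/-- If `γ X` held only a prefix of `∀ r. P`, it would be `⊥`, impossible for a decomposed variable,
or some `∀ r. Q'`; then the decreasing rule puts `Q'` next to `P` in `γ Y`, against reducedness. -/
theorem all_mem_iff {X Y : V} {r : R} (hd : Γ.dec X r = some Y) {P : Particle N R} :
    P.all r ∈ γ X ↔ P ∈ γ Y := by
  refine ⟨hγ.decreasing X r Y hd P, fun h => ?_⟩
  rcases hγ.unifier.increasing hd ((hγ.reduced Y).1 P h) h with h' | ⟨Q, hQ, hQP⟩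
  · exact h'
  · rcases hQP.eq_bot_or_eq_all with rfl | ⟨Q', rfl, hQ'⟩
    · exact (hγ.bot_notMem_of_dec hd hQ).elim
    · exact ((hγ.reduced Y).2 _ (hγ.decreasing X r Y hd Q' hQ) _ h hQ').elim

theorem exists_isPrefixOf_all_iff {X Y : V} {r : R} (hd : Γ.dec X r = some Y)
    {P : Particle N R} :
    (∃ Q ∈ γ X, Q.IsPrefixOf (P.all r)) ↔ ∃ Q ∈ γ Y, Q.IsPrefixOf P := by
  constructor
  · rintro ⟨Q, hQ, hQP⟩
    rcases hQP.eq_bot_or_eq_all with rfl | ⟨Q', rfl, hQ'⟩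
    · exact (hγ.bot_notMem_of_dec hd hQ).elim
    · exact ⟨Q', (hγ.all_mem_iff hd).mp hQ, hQ'⟩
  · rintro ⟨Q, hQ, hQP⟩
    exact ⟨Q.all r, (hγ.all_mem_iff hd).mpr hQ, Particle.all_isPrefixOf_all.mpr hQP⟩

theorem eq_bot_of_mem {X : V} (hX : X ∈ Γ.botVars) {P : Particle N R} (hP : P ∈ γ X) :
    P = Particle.bot := by
  rw [(hγ.choices X).1.mp hX] at hP
  exact Finset.mem_singleton.mp hP

variable [Fintype V]

theorem particlePair_bot : particlePair γ Particle.bot = (Γ.botVars, ∅) := by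
  ext X
  · simp [hγ.mem_botVars_iff]
  · simp [Particle.not_isPrefixOf_bot]

theorem particlePair_const :
    particlePair γ (Particle.name Γ.const) = (Γ.constVars, Γ.botVars) := by
  ext X
  · simp [(hγ.choices X).2]
  · simp [hγ.mem_botVars_iff, Particle.isPrefixOf_name]

/-- Disjointness is reducedness. For the prefix part of a flat subsumption, a prefix of a prefix of
`P` is again a prefix of `P`. -/
theorem isShortcut_particlePair {P : Particle N R} (hP : ∃ X, P ∈ γ X) :
    Γ.IsShortcut (particlePair γ P) where
  disjoint := Finset.disjoint_left.mpr fun X hX hX' => by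
    rw [mem_particlePair_fst] at hX
    obtain ⟨Q, hQ, hQP⟩ := mem_particlePair_snd.mp hX'
    exact (hγ.reduced X).2 _ hQ _ hX hQP
  nonempty := hP.imp fun X hX => mem_particlePair_fst.mpr hX
  bottom := by
    rintro ⟨X, hX, hXb⟩
    obtain rfl := hγ.eq_bot_of_mem hXb (mem_particlePair_fst.mp hX)
    simp [hγ.particlePair_bot]
  satisfies := fun f hf => by
    constructor
    · intro h
      rw [mem_particlePair_fst] at h
      simpa using hγ.unifier.flat hf ((hγ.reduced _).1 P h) h
    · intro h
      obtain ⟨Q, hQ, hQP⟩ := mem_particlePair_snd.mp h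
      obtain ⟨X, hX, h' | ⟨T, hT, hTQ⟩⟩ := hγ.unifier.flat hf ((hγ.reduced _).1 Q hQ) hQ
      · exact ⟨X, hX, mem_particlePair_snd.mpr ⟨Q, h', hQP⟩⟩
      · exact ⟨X, hX, mem_particlePair_snd.mpr ⟨T, hT, hTQ.trans hQP⟩⟩

theorem exists_all_mem {P : Particle N R} {r : R} (h : Γ.HasDecVar r (particlePair γ P).1) :
    ∃ X, P.all r ∈ γ X := by
  obtain ⟨X, Y, hd, hY⟩ := h
  exact ⟨X, (hγ.all_mem_iff hd).mpr (mem_particlePair_fst.mp hY)⟩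

theorem resolvedBy_particlePair {P : Particle N R} {r : R}
    (h : Γ.HasDecVar r (particlePair γ P).1) :
    Γ.ResolvedBy r (particlePair γ P) (particlePair γ (P.all r)) where
  exists_dec := h
  main_parent Y Z hd := by simp [hγ.all_mem_iff hd]
  pre_parent Y Z hd := by simp [hγ.exists_isPrefixOf_all_iff hd]
  main_dec Y Z hd := by simp [hγ.all_mem_iff hd]
  pre_dec Y Z hd := by simp [hγ.exists_isPrefixOf_all_iff hd]
  bottom hb := by
    obtain ⟨_, Z, -, hZ⟩ := h
    -- A `⊥`-variable contains `P`, so `P = ⊥`; the only prefix of `∀ r. ⊥` is then `⊥`.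
    obtain rfl := hγ.eq_bot_of_mem (hb hZ) (mem_particlePair_fst.mp hZ)
    intro X hX
    obtain ⟨Q, hQ, hQP⟩ := mem_particlePair_snd.mp hX
    rcases hQP.eq_bot_or_eq_all with rfl | ⟨Q', rfl, hQ'⟩
    · exact hγ.mem_botVars_iff.mpr hQ
    · exact (Particle.not_isPrefixOf_bot _ hQ').elim

/-! ### Induction on particle length -/

omit hγ in
theorem exists_length_bound (γ : V → NormalForm N R) :
    ∃ n, ∀ X, ∀ P ∈ γ X, P.roles.length ≤ n :=
  ⟨Finset.univ.sup fun X => (γ X).sup fun P => P.roles.length, fun X _ hP =>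
    (Finset.le_sup (f := fun P : Particle N R => P.roles.length) hP).trans
      (Finset.le_sup (f := fun X => (γ X).sup fun P => P.roles.length) (Finset.mem_univ X))⟩

/-- Induction on the particles of `γ`, from the longer ones to the shorter ones. -/
theorem particle_induction {motive : Particle N R → Prop}
    (step : ∀ P, (∃ X, P ∈ γ X) →
      (∀ r, Γ.HasDecVar r (particlePair γ P).1 → motive (P.all r)) → motive P)
    {P : Particle N R} (hP : ∃ X, P ∈ γ X) : motive P := by
  obtain ⟨n, hn⟩ := exists_length_bound γ
  induction hk : n - P.roles.length using Nat.strong_induction_on generalizing P with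
  | _ k ih =>
    refine step P hP fun r hr => ?_
    obtain ⟨X, hX⟩ := hγ.exists_all_mem hr
    -- Since `∀ r. P` occurs in `γ`, the truncated difference strictly drops.
    have hlen : P.roles.length + 1 ≤ n := hn X _ hX
    refine ih _ ?_ ⟨X, hX⟩ rfl
    change n - (P.roles.length + 1) < k
    omega

theorem particlePair_mem_allShortcuts {P : Particle N R} (hP : ∃ X, P ∈ γ X) :
    particlePair γ P ∈ Γ.allShortcuts :=
  hγ.particle_induction (motive := fun P => particlePair γ P ∈ Γ.allShortcuts)
    (fun _ hP ih => mem_allShortcuts (hγ.isShortcut_particlePair hP) fun r hr =>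
      ⟨_, ih r hr, hγ.resolvedBy_particlePair hr⟩) hP

/-- The set `S` is arbitrary so that this applies to the output of `checkExistence`. -/
theorem exists_heightZero_reachable {P : Particle N R} (hP : ∃ X, P ∈ γ X)
    {S : Finset (Finset V × Finset V)} (hS : ∀ P, (∃ X, P ∈ γ X) → particlePair γ P ∈ S) :
    ∃ s₀ ∈ S, Γ.HeightZero s₀ ∧
      Relation.ReflTransGen (fun a b => a ∈ S ∧ b ∈ S ∧ ∃ r, Γ.ResolvedBy r a b)
        (particlePair γ P) s₀ :=
  hγ.particle_induction (motive := fun P => ∃ s₀ ∈ S, Γ.HeightZero s₀ ∧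
      Relation.ReflTransGen (fun a b => a ∈ S ∧ b ∈ S ∧ ∃ r, Γ.ResolvedBy r a b)
        (particlePair γ P) s₀)
    (fun P hP ih => by
      by_cases h0 : Γ.HeightZero (particlePair γ P)
      · exact ⟨_, hS _ hP, h0, .refl⟩
      · simp only [HeightZero, not_forall, not_not] at h0
        obtain ⟨r, hr⟩ := h0
        obtain ⟨s₀, hs₀, hz, hreach⟩ := ih r hr
        exact ⟨s₀, hs₀, hz, hreach.head
          ⟨hS _ hP, hS _ (hγ.exists_all_mem hr), r, hγ.resolvedBy_particlePair hr⟩⟩) hP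

theorem heightZeroShortcuts_ne_empty {P : Particle N R} (hP : ∃ X, P ∈ γ X) :
    Γ.heightZeroShortcuts ≠ ∅ := by
  classical
  refine hγ.particle_induction (motive := fun _ => Γ.heightZeroShortcuts ≠ ∅)
    (fun P hP ih => ?_) hP
  by_cases h0 : Γ.HeightZero (particlePair γ P)
  · refine Finset.ne_empty_of_mem (a := particlePair γ P) ?_
    simp only [heightZeroShortcuts, Finset.mem_filter, Finset.mem_univ, true_and]
    exact ⟨hγ.isShortcut_particlePair hP, h0⟩
  · simp only [HeightZero, not_forall, not_not] at h0
    obtain ⟨r, hr⟩ := h0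
    exact ih r hr

/-! ### Survival under pruning -/

omit hγ in
/-- The longest prefix of `P` that occurs in `γ` gives a shortcut supporting that of `P`. -/
theorem exists_dependsOn_particlePair {P : Particle N R}
    (hne : (particlePair γ P).2 ≠ ∅) :
    ∃ Q, (∃ X, Q ∈ γ X) ∧ DependsOn (particlePair γ P) (particlePair γ Q) := by
  classical
  let T : Finset (Particle N R) := (Finset.univ.biUnion γ).filter fun Q => Q.IsPrefixOf P
  have hT : ∀ Q, Q ∈ T ↔ (∃ X, Q ∈ γ X) ∧ Q.IsPrefixOf P := fun Q => by simp [T]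
  have hTne : T.Nonempty := by
    obtain ⟨X, hX⟩ := Finset.nonempty_iff_ne_empty.mpr hne
    obtain ⟨Q, hQ, hQP⟩ := mem_particlePair_snd.mp hX
    exact ⟨Q, (hT Q).mpr ⟨⟨X, hQ⟩, hQP⟩⟩
  -- By maximality, every prefix of `P` in `γ` is `Q` or a prefix of `Q`.
  obtain ⟨Q, hQT, hmax⟩ := T.exists_max_image (fun Q => Q.roles.length) hTne
  obtain ⟨hQ, hQP⟩ := (hT Q).mp hQT
  refine ⟨Q, hQ, fun X => ?_⟩
  simp only [mem_particlePair_fst, mem_particlePair_snd]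
  constructor
  · rintro ⟨Q', hQ', hQP'⟩
    rcases hQP'.of_length_le hQP (hmax Q' ((hT Q').mpr ⟨⟨X, hQ'⟩, hQP'⟩)) with rfl | h
    · exact .inl hQ'
    · exact .inr ⟨Q', hQ', h⟩
  · rintro (h | ⟨Q', hQ', h⟩)
    · exact ⟨Q, h, hQP⟩
    · exact ⟨Q', hQ', h.trans hQP⟩

/-- The invariant concerns all particles of `γ` at once, because supporters and resolvers are pairs
of other particles. -/
theorem particlePair_mem_prune {S : Finset (Finset V × Finset V)}
    (hS : ∀ P, (∃ X, P ∈ γ X) → particlePair γ P ∈ S) (P : Particle N R) (hP : ∃ X, P ∈ γ X) :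
    particlePair γ P ∈ Γ.prune S := by
  classical
  have hE : ∀ P, (∃ X, P ∈ γ X) → particlePair γ P ∈ checkExistence S := fun P hP => by
    refine Finset.mem_filter.mpr ⟨hS P hP, or_iff_not_imp_left.mpr fun hne => ?_⟩
    obtain ⟨Q, hQ, hdep⟩ := exists_dependsOn_particlePair hne
    exact ⟨_, hS Q hQ, hdep⟩
  exact Finset.mem_filter.mpr ⟨hE P hP, hγ.exists_heightZero_reachable hP hE⟩

theorem particlePair_mem_pruneLoop {P : Particle N R} (hP : ∃ X, P ∈ γ X) :
    particlePair γ P ∈ Γ.pruneLoop Γ.allShortcuts :=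
  repeatLoop_invariant Γ.prune Finset.card Γ.prune_measure
    (fun S => ∀ P, (∃ X, P ∈ γ X) → particlePair γ P ∈ S)
    (fun _ hS => hγ.particlePair_mem_prune hS) Γ.allShortcuts
    (fun _ hP => hγ.particlePair_mem_allShortcuts hP) P hP

theorem botInitialIn (hb : Γ.botVars ≠ ∅) {S : Finset (Finset V × Finset V)}
    (hS : ∀ {P}, (∃ X, P ∈ γ X) → particlePair γ P ∈ S) : Γ.BotInitialIn S := by
  obtain ⟨X, hX⟩ := Finset.nonempty_iff_ne_empty.mpr hb
  have h := hS ⟨X, hγ.mem_botVars_iff.mp hX⟩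
  rwa [hγ.particlePair_bot] at h

theorem constInitialIn (hc : Γ.constVars ≠ ∅) {S : Finset (Finset V × Finset V)}
    (hS : ∀ {P}, (∃ X, P ∈ γ X) → particlePair γ P ∈ S) : Γ.ConstInitialIn S := by
  obtain ⟨X, hX⟩ := Finset.nonempty_iff_ne_empty.mpr hc
  have h := hS ⟨X, (hγ.choices X).2.mp hX⟩
  rw [hγ.particlePair_const] at h
  exact ⟨_, Finset.Subset.refl _, h⟩

end IsGoodUnifier

end NormalizedProblem

end FLBot

theorem mainTheorem1 {V : Type w} {N : Type v} {R : Type u} [Fintype V]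
    (Γ : FLBot.NormalizedProblem V N R) (hstart : Γ.startGoals.Nonempty)
    (γ : V → FLBot.NormalForm N R) (hred : ∀ X, (γ X).Reduced)
    (hγ : Γ.IsUnifier γ) (hdec : Γ.ObeysDecreasingRule γ) (hchoice : Γ.AgreesWithChoices γ) :
    Γ.main = FLBot.Outcome.success := by
  have hg : Γ.IsGoodUnifier γ := ⟨hred, hγ, hdec, hchoice⟩
  have hA {P} (hP : ∃ X, P ∈ γ X) := hg.particlePair_mem_allShortcuts hP
  have hL {P} (hP : ∃ X, P ∈ γ X) := hg.particlePair_mem_pruneLoop hP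
  -- A start subsumption makes `A` or `⊥` occur in `γ`, which starts the induction.
  have hne : Γ.heightZeroShortcuts ≠ ∅ ∧ (Γ.botVars = ∅ → Γ.constVars ≠ ∅) := by
    obtain ⟨p, ⟨X, hX, -⟩ | ⟨X, hX, -⟩⟩ := hstart
    · exact ⟨hg.heightZeroShortcuts_ne_empty ⟨X, (hchoice X).2.mp hX⟩,
        fun _ => Finset.ne_empty_of_mem hX⟩
    · exact ⟨hg.heightZeroShortcuts_ne_empty ⟨X, hg.mem_botVars_iff.mp hX⟩,
        fun h => (Finset.ne_empty_of_mem hX h).elim⟩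
  unfold FLBot.NormalizedProblem.main
  rw [if_neg hne.1]
  by_cases hb : Γ.botVars = ∅
  · rw [if_pos hb, if_pos (hg.constInitialIn (hne.2 hb) hA)]
  · rw [if_neg hb]
    have hbA := hg.botInitialIn hb hA
    have hbL := hg.botInitialIn hb hL
    by_cases hc : Γ.constVars = ∅
    · rw [if_pos hc, if_neg (not_not.mpr hbA), if_pos hbL]
    · have hcA := hg.constInitialIn hc hA
      have hcL := hg.constInitialIn hc hL
      rw [if_neg hc, if_neg (by simp [hbA, hcA]), if_pos ⟨hbL, hcL⟩]
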